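/- Let $n\ge 0$. For real $x,y$ let $R_n[x,y]$ and (for $x\neq 0$) $\Psi_n[x,y]$ be the $(n+1)\times(n+1)$ matrices with entries $$(R_n[x,y])_{ij}=x^{j-1}y^{i-1}\binom{i+j-2}{j-1},\qquad (\Psi_n[x,y])_{ij}=x^{i-j}y^{i+j-2}\binom{i+j-2}{j-1},\qquad 1\le i,j\le n+1,$$ and let $Lp_n(\alpha,\beta,\gamma)=(k_{ij})_{1\le i,j\le n+1}$ be the lattice path matrix: $k_{1j}=\alpha^{j-1}$, $k_{i1}=\beta^{i-1}$, and $k_{ij}=\alpha k_{i,j-1}+\beta k_{i-1,j}+\gamma k_{i-1,j-1}$ for $i,j\ge 2$. A matrix is strictly totally positive (STP) if all its minors are positive. The bidiagonal decomposition of a nonsingular totally positive $(n+1)\times(n+1)$ matrix $A$ is the factorization $A=F_n\cdots F_1\,D\,G_1\cdots G_n$, where $D=\mathrm{diag}(p_{11},\dots,p_{n+1,n+1})$ with $p_{ii}>0$, $F_k$ is the unit lower bidiagonal matrix with subdiagonal $(0,\dots,0,m_{k+1,1},m_{k+2,2},\dots,m_{n+1,n+1-k})$, $G_k$ is the unit upper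 bidiagonal matrix with superdiagonal $(0,\dots,0,\widetilde m_{k+1,1},\dots,\widetilde m_{n+1,n+1-k})$, all $m_{ij},\widetilde m_{ij}\ge 0$, and $m_{ij}=0$ (resp. $\widetilde m_{ij}=0$) implies $m_{hj}=0$ (resp. $\widetilde m_{hj}=0$) for all $h>i$. Quantities depending on real data are computable to high relative accuracy (HRA) on a set of data if one arithmetic algorithm (a finite sequence of operations $+,-,\times,/$ on the data, the number $1$ and earlier results, not depending on the values of the data) and a constant $K>0$ exist such that, for all data in the set and every unit round-off $0<u\le 1/2$, whenever each operation is carried out in floating point arithmetic with result $(a\circ b)(1+\delta)$, $|\delta|\le u$, no division by zero occurs and every computed output $\tilde z$ satisfies $|z-\tilde z|\le K u\,|z|$, $z$ being the exact quantity. Then: (i) If $x,y>0$, then $R_n[x,y]=Lp_n(x,y,0)$ and this matrix is STP; moreover, on the set of data $\{(x,y):x,y>0\}$, the entries $p_{ii},m_{ij},\widetilde m_{ij}$ of the bidiagonal decomposition of $R_n[x,y]$ are computable to HRA. (ii) If $xy>0$, then $\Psi_n[x,y]=Lp_n(y/x,xy,0)$ and this matrix is STP; moreover, on the set of data $\{(x,y):xy>0\}$,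 the entries $p_{ii},m_{ij},\widetilde m_{ij}$ of the bidiagonal decomposition of $\Psi_n[x,y]$ are computable to HRA. -/

import Mathlib

namespace PascalHRA

noncomputable section

/-! ### The matrices

All matrices are `(n+1) × (n+1)`; rows and columns are indexed from `0`, so that the index `i`
below is the usual index `i + 1`. -/

/-- The generalized symmetric Pascal matrix `R_n[x,y]`, with (1-based) entries
`x^(j-1) y^(i-1) binom(i+j-2, j-1)`. -/
def genPascal (n : ℕ) (x y : ℝ) : Matrix (Fin (n + 1)) (Fin (n + 1)) ℝ :=
  Matrix.of fun i j =>
    x ^ (j : ℕ) * y ^ (i : ℕ) * (Nat.choose ((i : ℕ) + (j : ℕ)) (j : ℕ) : ℝ)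

/-- The extended generalized symmetric Pascal matrix `Ψ_n[x,y]`, with (1-based) entries
`x^(i-j) y^(i+j-2) binom(i+j-2, j-1)`; the exponent `i - j` is an integer. -/
def extPascal (n : ℕ) (x y : ℝ) : Matrix (Fin (n + 1)) (Fin (n + 1)) ℝ :=
  Matrix.of fun i j =>
    x ^ (((i : ℕ) : ℤ) - ((j : ℕ) : ℤ)) * y ^ ((i : ℕ) + (j : ℕ)) *
      (Nat.choose ((i : ℕ) + (j : ℕ)) (j : ℕ) : ℝ)

/-- The weighted lattice path numbers: first row `1, α, α², …`, first column `1, β, β², …`, and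
`k_{i,j} = α k_{i,j-1} + β k_{i-1,j} + γ k_{i-1,j-1}` elsewhere. -/
def latticePathNumber (α β γ : ℝ) : ℕ → ℕ → ℝ
  | 0, j => α ^ j
  | i + 1, 0 => β ^ (i + 1)
  | i + 1, j + 1 =>
      α * latticePathNumber α β γ (i + 1) j + β * latticePathNumber α β γ i (j + 1) +
        γ * latticePathNumber α β γ i j

/-- The lattice path matrix `Lp_n(α,β,γ)`. -/
def latticePathMatrix (n : ℕ) (α β γ : ℝ) : Matrix (Fin (n + 1)) (Fin (n + 1)) ℝ :=
  Matrix.of fun i j => latticePathNumber α β γ (i : ℕ) (j : ℕ)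

/-- Strict total positivity: every minor, of every order, is positive. -/
def IsSTP {m : ℕ} (A : Matrix (Fin m) (Fin m) ℝ) : Prop :=
  ∀ (k : ℕ) (r c : Fin k → Fin m), StrictMono r → StrictMono c → 0 < (A.submatrix r c).det

/-! ### The bidiagonal decomposition

A bidiagonal decomposition is stored in one matrix `B`, where (for 1-based indices)
`B i j` is the multiplier `m_{ij}` of the lower factors for `i > j`, `B j i` is the multiplier
`m̃_{ij}` of the upper factors for `i > j`, and `B i i` is the pivot `p_{ii}`. -/

/-- The unit lower bidiagonal factor `F_k` (`1 ≤ k ≤ n`): its subdiagonal is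
`0, …, 0, m_{k+1,1}, m_{k+2,2}, …, m_{n+1,n+1-k}`, with `m_{k+1,1}` in (1-based) row `k + 1`. -/
def lowerFactor {n : ℕ} (B : Matrix (Fin (n + 1)) (Fin (n + 1)) ℝ) (k : ℕ) :
    Matrix (Fin (n + 1)) (Fin (n + 1)) ℝ :=
  Matrix.of fun r c =>
    if r = c then 1
    else if (r : ℕ) = (c : ℕ) + 1 ∧ k ≤ (r : ℕ) then
      B r ⟨(r : ℕ) - k, lt_of_le_of_lt (Nat.sub_le _ _) r.isLt⟩
    else 0

/-- The unit upper bidiagonal factor `G_k` (`1 ≤ k ≤ n`): its superdiagonal is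
`0, …, 0, m̃_{k+1,1}, m̃_{k+2,2}, …, m̃_{n+1,n+1-k}`, with `m̃_{k+1,1}` in (1-based) column
`k + 1`. -/
def upperFactor {n : ℕ} (B : Matrix (Fin (n + 1)) (Fin (n + 1)) ℝ) (k : ℕ) :
    Matrix (Fin (n + 1)) (Fin (n + 1)) ℝ :=
  Matrix.of fun r c =>
    if r = c then 1
    else if (c : ℕ) = (r : ℕ) + 1 ∧ k ≤ (c : ℕ) then
      B ⟨(c : ℕ) - k, lt_of_le_of_lt (Nat.sub_le _ _) c.isLt⟩ c
    else 0

/-- `F_k F_{k-1} ⋯ F_1`. -/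
def lowerProd {n : ℕ} (B : Matrix (Fin (n + 1)) (Fin (n + 1)) ℝ) :
    ℕ → Matrix (Fin (n + 1)) (Fin (n + 1)) ℝ
  | 0 => 1
  | k + 1 => lowerFactor B (k + 1) * lowerProd B k

/-- `G_1 ⋯ G_{k-1} G_k`. -/
def upperProd {n : ℕ} (B : Matrix (Fin (n + 1)) (Fin (n + 1)) ℝ) :
    ℕ → Matrix (Fin (n + 1)) (Fin (n + 1)) ℝ
  | 0 => 1
  | k + 1 => upperProd B k * upperFactor B (k + 1)

/-- `B` is the bidiagonal decomposition of the (nonsingular, totally positive) matrix `A`: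
`A = F_n ⋯ F_1 D G_1 ⋯ G_n` with positive pivots and nonnegative multipliers, normalized by the
condition that a zero multiplier is followed by zeros only (which makes it unique). -/
structure IsBidiagonalDecomposition {n : ℕ} (A B : Matrix (Fin (n + 1)) (Fin (n + 1)) ℝ) :
    Prop where
  factorization : A = lowerProd B n * Matrix.diagonal (fun i => B i i) * upperProd B n
  pivot_pos : ∀ i, 0 < B i i
  multiplier_nonneg : ∀ i j, i ≠ j → 0 ≤ B i j
  lower_zero : ∀ i j h, j < i → i < h → B i j = 0 → B h j = 0
  upper_zero : ∀ i j h, j < i → i < h → B j i = 0 → B j h = 0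

/-! ### Algorithms in floating point arithmetic and high relative accuracy -/

/-- The elementary arithmetic operations. -/
inductive ArithOp
  | add
  | sub
  | mul
  | div

/-- The exact result of an operation. -/
def ArithOp.exact : ArithOp → ℝ → ℝ → ℝ
  | .add, a, b => a + b
  | .sub, a, b => a - b
  | .mul, a, b => a * b
  | .div, a, b => a / b

/-- An operand of a program with `p` input data and `N` operations: an input datum, the
number `1`, or the result of an operation. -/
inductive Operand (p N : ℕ)
  | data (i : Fin p)
  | one
  | result (k : Fin N)

/-- The value of an operand, given the input data `d` and the results `v` of the operations. -/
def Operand.value {p N : ℕ} (d : Fin p → ℝ) (v : Fin N → ℝ) : Operand p N → ℝ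
  | .data i => d i
  | .one => 1
  | .result k => v k

/-- The operand is available when operation number `k` is carried out. -/
def Operand.Before {p N : ℕ} (k : Fin N) : Operand p N → Prop
  | .data _ => True
  | .one => True
  | .result l => l < k

/-- An arithmetic algorithm with `p` real input data and outputs indexed by `ι`: a finite sequence
of elementary operations, each applied to input data, the number `1` and earlier results. The
program does not depend on the values of the data. -/
structure Program (p : ℕ) (ι : Type) where
  /-- the number of operations -/
  size : ℕ
  op : Fin size → ArithOp
  left : Fin size → Operand p size
  right : Fin size → Operand p size
  left_before : ∀ k, (left k).Before k
  right_before : ∀ k, (right k).Before k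
  output : ι → Operand p size

/-- `v` is a possible sequence of computed results of the program on the data `d` in floating point
arithmetic with unit round-off `u`, in the standard model `fl(a ∘ b) = (a ∘ b)(1 + δ)`,
`|δ| ≤ u`. -/
def Program.IsRun {p : ℕ} {ι : Type} (P : Program p ι) (u : ℝ) (d : Fin p → ℝ)
    (v : Fin P.size → ℝ) : Prop :=
  ∀ k, ∃ δ : ℝ, |δ| ≤ u ∧
    v k = (P.op k).exact ((P.left k).value d v) ((P.right k).value d v) * (1 + δ)

/-- The quantities `f d` are computed to high relative accuracy for all data `d ∈ S`: one
algorithm computes them with a relative error of at most `K u`, in arithmetic of any unit round-off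
`u` (which is at most `1/2`, the value for one binary digit), where `K` depends neither on `u` nor
on the data; no division by zero ever occurs. As an execution without rounding errors is a run for
every `u`, the algorithm computes `f d` exactly in exact arithmetic. -/
def ComputableToHRA {p : ℕ} {ι : Type} (S : Set (Fin p → ℝ)) (f : (Fin p → ℝ) → ι → ℝ) : Prop :=
  ∃ (P : Program p ι) (K : ℝ), 0 < K ∧
    ∀ d ∈ S, ∀ u : ℝ, 0 < u → u ≤ 1 / 2 → ∀ v : Fin P.size → ℝ, P.IsRun u d v →
      (∀ k, P.op k = ArithOp.div → (P.right k).value d v ≠ 0) ∧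
      ∀ o : ι, |(P.output o).value d v - f d o| ≤ K * u * |f d o|

/-- The bidiagonal decomposition of `A x y` exists and (all its entries) can be computed to high
relative accuracy from the data `x, y`, for all `(x, y) ∈ S`. -/
def BidiagonalDecompositionComputableToHRA {n : ℕ} (S : Set (ℝ × ℝ))
    (A : ℝ → ℝ → Matrix (Fin (n + 1)) (Fin (n + 1)) ℝ) : Prop :=
  ∃ B : ℝ → ℝ → Matrix (Fin (n + 1)) (Fin (n + 1)) ℝ,
    (∀ x y, (x, y) ∈ S → IsBidiagonalDecomposition (A x y) (B x y)) ∧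
    ComputableToHRA {d : Fin 2 → ℝ | (d 0, d 1) ∈ S}
      (fun d (q : Fin (n + 1) × Fin (n + 1)) => B (d 0) (d 1) q.1 q.2)

end

end PascalHRA

namespace PascalHRA

open scoped Matrix

/-! ### Strict total positivity of the symmetric Pascal matrix -/

/-! Everything reduces to the kernel `C(i+j, j)`. The matrix `R_n[x,y]` is this kernel with rows
scaled by `y^i` and columns by `x^j`, and `Ψ_n[x,y] = R_n[y/x, xy]`, where both parameters are
positive as soon as `xy > 0`, even for negative `x` and `y`.

Minors of the kernel are positive (`det_choose_pos`): differences of successive rows are, by the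
hockey-stick identity, sums of rows with smaller column indices, and multilinearity expands the
determinant into smaller minors of the same kind.

By Vandermonde's identity `C(i+j, j) = ∑ C(i,k) C(j,k)`, the matrix `R_n[α,β]` is a lower Pascal
triangle times a diagonal times an upper one. The triangles factor with constant multipliers `β` and
`α`, and the pivots are `(αβ)^i`. Computing these needs only products and, for `Ψ_n`, one quotient
of data. No operation cancels, so relative errors stay bounded by a multiple of `u` depending only
on `n`. -/

theorem sum_range_choose_add (b c : ℕ) :
    ∑ s ∈ Finset.range (b + 1), ((s + c).choose c : ℝ) = ((b + (c + 1)).choose (c + 1) : ℝ) := by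
  induction b with
  | zero => simp
  | succ b ih =>
    rw [Finset.sum_range_succ, ih, show b + 1 + (c + 1) = (b + 1 + c) + 1 by ring,
      Nat.choose_succ_succ, show b + (c + 1) = b + 1 + c by ring]
    push_cast
    ring

theorem sum_Ioc_choose_add {a b : ℕ} (h : a ≤ b) (c : ℕ) :
    ∑ s ∈ Finset.Ioc a b, ((s + c).choose c : ℝ) =
      ((b + (c + 1)).choose (c + 1) : ℝ) - ((a + (c + 1)).choose (c + 1) : ℝ) := by
  rw [← sum_range_choose_add, ← sum_range_choose_add, eq_sub_iff_add_eq, add_comm,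
    Finset.range_eq_Ico, Finset.range_eq_Ico,
    ← Finset.sum_Ico_consecutive _ (Nat.zero_le (a + 1)) (Nat.succ_le_succ h)]
  congr 1
  exact Finset.sum_congr (by ext; simp) fun _ _ => rfl

/-- A determinant whose rows are sums over separated index sets of rows with positive minors is
positive. -/
theorem det_sum_rows_pos {k : ℕ} (S : Fin k → Finset ℕ) (f : ℕ → Fin k → ℝ)
    (hne : ∀ i, (S i).Nonempty) (hsep : ∀ i j, i < j → ∀ a ∈ S i, ∀ b ∈ S j, a < b)
    (hf : ∀ s : Fin k → ℕ, StrictMono s → 0 < (Matrix.of fun i j => f (s i) j).det) :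
    0 < (Matrix.of fun i j => ∑ s ∈ S i, f s j).det := by
  have h := (Matrix.detRowAlternating (R := ℝ) (n := Fin k)).toMultilinearMap.map_sum_finset
    (fun (_ : Fin k) (s : ℕ) => f s) S
  have h1 : (Matrix.of fun i j => ∑ s ∈ S i, f s j).det =
      ∑ s ∈ Fintype.piFinset S, (Matrix.of fun i j => f (s i) j).det := by
    refine Eq.trans ?_ h
    change Matrix.det _ = Matrix.det _
    congr 1
    ext i j
    simp
  rw [h1]
  refine Finset.sum_pos (fun s hs => hf s fun i j hij => ?_) (Fintype.piFinset_nonempty.2 hne)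
  rw [Fintype.mem_piFinset] at hs
  exact hsep i j hij _ (hs i) _ (hs j)

/-- Double induction, on the order and then on the smallest column index. Row differences become
sums over the disjoint, ordered intervals `(r i, r (i+1)]` with positive column indices lowered by
one, so `det_sum_rows_pos` applies. -/
theorem det_choose_pos (k : ℕ) : ∀ r c : Fin k → ℕ, StrictMono r → StrictMono c →
    0 < (Matrix.of fun i j => ((r i + c j).choose (c j) : ℝ)).det := by
  induction k with
  | zero => intro r c _ _; simp
  | succ k ih =>
    intro r c hr hc
    obtain ⟨m, hm⟩ : ∃ m, c 0 = m := ⟨_, rfl⟩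
    have hlt : ∀ i : Fin k, r i.castSucc < r i.succ := fun i => hr i.castSucc_lt_succ
    induction m generalizing r c with
    | zero =>
      have hpos : ∀ j : Fin k, ∃ d, c j.succ = d + 1 := fun j =>
        Nat.exists_eq_succ_of_ne_zero (by have := hc j.succ_pos; omega)
      choose d hd using hpos
      have hdm : StrictMono d := fun i j hij => by
        have := hc (Fin.succ_lt_succ_iff.2 hij)
        rw [hd, hd] at this
        omega
      -- Column index `0` gives a column of ones, which differencing turns into `(1, 0, …, 0)`;
      -- expanding along it lowers the order.
      have hrow := Matrix.det_eq_of_forall_row_eq_smul_add_pred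
        (A := Matrix.of fun i j => ((r i + c j).choose (c j) : ℝ))
        (B := Matrix.of (Fin.cons (fun j => ((r 0 + c j).choose (c j) : ℝ)) fun i j =>
          ((r i.succ + c j).choose (c j) : ℝ) - ((r i.castSucc + c j).choose (c j) : ℝ)))
        (fun _ => 1) (fun j => by simp) (fun i j => by simp)
      rw [hrow, Matrix.det_succ_column_zero, Fin.sum_univ_succ, Finset.sum_eq_zero, add_zero]
      · have := det_sum_rows_pos (fun i : Fin k => Finset.Ioc (r i.castSucc) (r i.succ))
          (fun s j => ((s + d j).choose (d j) : ℝ)) (fun i => Finset.nonempty_Ioc.2 (hlt i))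
          (fun i j hij a ha b hb => by
            have h1 := (Finset.mem_Ioc.1 ha).2
            have h2 := (Finset.mem_Ioc.1 hb).1
            have h3 : r i.succ ≤ r j.castSucc := hr.monotone (by
              rw [Fin.le_def]; simpa using hij)
            omega)
          (fun s hs => ih s d hs hdm)
        convert this using 1
        simp only [Matrix.of_apply, Fin.cons_zero, hm]
        simp only [Fin.val_zero, pow_zero, Nat.choose_zero_right, Nat.cast_one, one_mul]
        congr 1
        ext i j
        simp [sum_Ioc_choose_add (hlt i).le, hd]
      · intro i _
        simp [hm]
    | succ m ihm =>
      have hpos : ∀ j : Fin (k + 1), ∃ d, c j = d + 1 := fun j =>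
        Nat.exists_eq_succ_of_ne_zero (by have := hc.monotone (Fin.zero_le j); omega)
      choose d hd using hpos
      have hdm : StrictMono d := fun i j hij => by
        have := hc hij
        rw [hd, hd] at this
        omega
      -- The undifferenced first row is a hockey-stick sum too, over `[0, r 0]`, so the order stays
      -- and every column index drops by one.
      have hrow := Matrix.det_eq_of_forall_row_eq_smul_add_pred
        (A := Matrix.of fun i j => ((r i + c j).choose (c j) : ℝ))
        (B := Matrix.of fun i j => ∑ s ∈ (Fin.cons (Finset.range (r 0 + 1))
          (fun i : Fin k => Finset.Ioc (r i.castSucc) (r i.succ)) :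
            Fin (k + 1) → Finset ℕ) i, ((s + d j).choose (d j) : ℝ))
        (fun _ => 1) (fun j => by simp [sum_range_choose_add, hd])
        (fun i j => by simp [sum_Ioc_choose_add (hlt i).le, hd])
      rw [hrow]
      refine det_sum_rows_pos _ (fun s j => ((s + d j).choose (d j) : ℝ)) (fun i => ?_)
        (fun i j hij a ha b hb => ?_)
        (fun s hs => ihm s d hs hdm (by have := hd 0; omega) fun i => hs i.castSucc_lt_succ)
      · refine Fin.cases ?_ (fun i => ?_) i
        · simp
        · simpa using hlt i
      · have h1 : a ≤ r i := by
          revert ha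
          refine Fin.cases (fun ha => ?_) (fun i ha => ?_) i
          · simpa [Nat.lt_succ_iff] using ha
          · simp only [Fin.cons_succ, Finset.mem_Ioc] at ha
            exact ha.2
        obtain ⟨j, rfl⟩ := Fin.exists_succ_eq.2 (Fin.ne_zero_of_lt hij)
        simp only [Fin.cons_succ, Finset.mem_Ioc] at hb
        have h3 : r i ≤ r j.castSucc := hr.monotone (by
          rw [Fin.le_def]; rw [Fin.lt_def] at hij; simp at hij ⊢; omega)
        omega

theorem isSTP_genPascal (n : ℕ) {x y : ℝ} (hx : 0 < x) (hy : 0 < y) :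
    IsSTP (genPascal n x y) := by
  intro k r c hr hc
  have h : (genPascal n x y).submatrix r c =
      Matrix.of fun i j => y ^ (r i : ℕ) * (Matrix.of fun i j => x ^ (c j : ℕ) *
        (Matrix.of fun i j =>
          (((r i : ℕ) + (c j : ℕ)).choose (c j : ℕ) : ℝ)) i j) i j := by
    ext i j
    simp only [genPascal, Matrix.submatrix_apply, Matrix.of_apply]
    ring
  rw [h, Matrix.det_mul_column, Matrix.det_mul_row]
  have := det_choose_pos k (fun i => r i) (fun i => c i) (fun i j h => hr h) (fun i j h => hc h)
  exact mul_pos (Finset.prod_pos fun _ _ => pow_pos hy _)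
    (mul_pos (Finset.prod_pos fun _ _ => pow_pos hx _) this)

/-! ### Lattice path matrices -/

theorem latticePathNumber_zero_right (α β : ℝ) (i j : ℕ) :
    latticePathNumber α β 0 i j = α ^ j * β ^ i * ((i + j).choose j : ℝ) := by
  induction i generalizing j with
  | zero => simp [latticePathNumber]
  | succ i ih =>
    induction j with
    | zero => simp [latticePathNumber]
    | succ j ihj =>
      rw [latticePathNumber, ihj, ih, show i + 1 + (j + 1) = (i + 1 + j) + 1 by ring,
        Nat.choose_succ_succ, show i + (j + 1) = i + 1 + j by ring]
      push_cast
      ring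

theorem genPascal_eq_latticePathMatrix (n : ℕ) (x y : ℝ) :
    genPascal n x y = latticePathMatrix n x y 0 := by
  ext i j
  simp [genPascal, latticePathMatrix, latticePathNumber_zero_right]

theorem extPascal_eq_genPascal (n : ℕ) {x : ℝ} (hx : x ≠ 0) (y : ℝ) :
    extPascal n x y = genPascal n (y / x) (x * y) := by
  ext i j
  simp only [genPascal, extPascal, Matrix.of_apply]
  rw [zpow_sub₀ hx, zpow_natCast, zpow_natCast, div_pow, mul_pow, pow_add]
  field_simp

/-! ### The bidiagonal decomposition -/

/-- The matrix storing the bidiagonal decomposition of `R_n[α,β]`. -/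
def pascalBD (n : ℕ) (α β : ℝ) : Matrix (Fin (n + 1)) (Fin (n + 1)) ℝ :=
  Matrix.of fun i j => if j < i then β else if i < j then α else (α * β) ^ (i : ℕ)

theorem pascalBD_transpose (n : ℕ) (α β : ℝ) : (pascalBD n α β)ᵀ = pascalBD n β α := by
  ext i j
  rcases lt_trichotomy i j with h | rfl | h
  · simp [pascalBD, h, h.not_gt]
  · simp [pascalBD, mul_comm]
  · simp [pascalBD, h, h.not_gt]

theorem upperProd_eq_transpose {n : ℕ} (B : Matrix (Fin (n + 1)) (Fin (n + 1)) ℝ) (k : ℕ) :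
    upperProd B k = (lowerProd Bᵀ k)ᵀ := by
  induction k with
  | zero => simp [upperProd, lowerProd]
  | succ k ih =>
    rw [upperProd, lowerProd, Matrix.transpose_mul, ih]
    congr 1
    ext i j
    simp [upperFactor, lowerFactor, eq_comm]

theorem lowerFactor_mul_apply_zero {n : ℕ} (B M : Matrix (Fin (n + 1)) (Fin (n + 1)) ℝ) (k : ℕ)
    (j : Fin (n + 1)) : (lowerFactor B k * M) 0 j = M 0 j := by
  rw [Matrix.mul_apply, Finset.sum_eq_single 0]
  · simp [lowerFactor]
  · intro b _ hb
    simp [lowerFactor, hb.symm]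
  · simp

theorem lowerFactor_pascalBD_mul_apply_succ {n : ℕ} (α β : ℝ)
    (M : Matrix (Fin (n + 1)) (Fin (n + 1)) ℝ) {k : ℕ} (hk : 0 < k) (i : Fin n)
    (j : Fin (n + 1)) :
    (lowerFactor (pascalBD n α β) k * M) i.succ j =
      M i.succ j + if k ≤ (i : ℕ) + 1 then β * M i.castSucc j else 0 := by
  have hne : i.succ ≠ i.castSucc := i.castSucc_lt_succ.ne'
  rw [Matrix.mul_apply, ← Finset.add_sum_erase _ _ (Finset.mem_univ i.succ),
    Finset.sum_eq_single_of_mem i.castSucc (by simp [hne.symm])]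
  · have hlt : (⟨(i : ℕ) + 1 - k, by omega⟩ : Fin (n + 1)) < i.succ := by
      rw [Fin.lt_def]; simp; omega
    by_cases h : k ≤ (i : ℕ) + 1
    · simp [lowerFactor, pascalBD, hne, h, hlt]
    · simp [lowerFactor, h, hne]
  · intro b hb hb'
    have h1 : i.succ ≠ b := by simpa [eq_comm] using hb
    have h2 : (i : ℕ) ≠ b := fun h => hb' (Fin.ext h.symm)
    simp [lowerFactor, h1, h2]

/-- The `k`-th factor adds `β` times the preceding row to each row of index at least `k`, which is
one step of Pascal's rule. Row `i` is thus changed only by the first `i` factors, whence the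
minimum. -/
theorem lowerProd_pascalBD_apply {n : ℕ} (α β : ℝ) (k : ℕ) (i j : Fin (n + 1)) :
    lowerProd (pascalBD n α β) k i j =
      if j ≤ i then ((min (i : ℕ) k).choose (i - j) : ℝ) * β ^ ((i : ℕ) - j) else 0 := by
  induction k generalizing i with
  | zero =>
    rcases lt_trichotomy i j with h | rfl | h
    · simp [lowerProd, h.ne, h]
    · simp [lowerProd]
    · obtain ⟨m, hm⟩ : ∃ m, (i : ℕ) - j = m + 1 := ⟨i - j - 1, by rw [Fin.lt_def] at h; omega⟩
      simp [lowerProd, h.ne', hm]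
  | succ k ih =>
    rw [lowerProd]
    refine Fin.cases ?_ (fun i => ?_) i
    · rw [lowerFactor_mul_apply_zero, ih]
      simp
    · rw [lowerFactor_pascalBD_mul_apply_succ _ _ _ k.succ_pos, ih, ih]
      simp only [Fin.le_def, Fin.val_succ, Fin.val_castSucc]
      by_cases hk : k + 1 ≤ (i : ℕ) + 1
      · rw [if_pos hk, min_eq_right (by omega), min_eq_right (by omega), min_eq_right (by omega)]
        rcases lt_trichotomy (j : ℕ) ((i : ℕ) + 1) with h | h | h
        · rw [if_pos h.le, if_pos (by omega), if_pos h.le,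
            show (i : ℕ) + 1 - j = (i - j) + 1 by omega, Nat.choose_succ_succ]
          push_cast
          ring
        · rw [if_pos h.le, if_neg (by omega), if_pos h.le, h]
          simp
        · rw [if_neg (by omega), if_neg (by omega), if_neg (by omega)]
          simp
      · rw [if_neg hk, min_eq_left (by omega), min_eq_left (by omega), add_zero]

theorem lowerProd_pascalBD {n : ℕ} (α β : ℝ) (i j : Fin (n + 1)) :
    lowerProd (pascalBD n α β) n i j =
      if j ≤ i then ((i : ℕ).choose j : ℝ) * β ^ ((i : ℕ) - j) else 0 := by
  rw [lowerProd_pascalBD_apply, min_eq_left (Nat.lt_succ_iff.1 i.isLt)]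
  split_ifs with h
  · rw [Nat.choose_symm h]
  · rfl

theorem sum_choose_mul_choose {n i : ℕ} (hi : i ≤ n) (j : ℕ) :
    ∑ k : Fin (n + 1), (i.choose k * j.choose k : ℝ) = ((i + j).choose j : ℝ) := by
  rw [Fin.sum_univ_eq_sum_range (fun k => (i.choose k * j.choose k : ℝ)) (n + 1),
    ← Finset.sum_subset (Finset.range_subset_range.2 (Nat.succ_le_succ hi))
      (fun k _ hk => by
        rw [Nat.choose_eq_zero_of_lt (by simpa [Nat.lt_succ_iff] using hk)]; simp),
    add_comm i j, Nat.choose_symm_add, Nat.add_choose_eq,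
    Finset.Nat.sum_antidiagonal_eq_sum_range_succ_mk, Nat.cast_sum]
  refine Finset.sum_congr rfl fun k hk => ?_
  rw [Nat.choose_symm (by simpa [Nat.lt_succ_iff] using hk), Nat.cast_mul, mul_comm]

theorem isBidiagonalDecomposition_genPascal (n : ℕ) {α β : ℝ} (hα : 0 < α) (hβ : 0 < β) :
    IsBidiagonalDecomposition (genPascal n α β) (pascalBD n α β) := by
  -- No multiplier vanishes, so the normalization conditions hold vacuously.
  have hpos : ∀ i j, 0 < pascalBD n α β i j := fun i j => by
    simp only [pascalBD, Matrix.of_apply]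
    split_ifs <;> positivity
  refine ⟨?_, fun i => hpos i i, fun i j _ => (hpos i j).le,
    fun i j _ _ _ h => absurd h (hpos i j).ne', fun i j _ _ _ h => absurd h (hpos j i).ne'⟩
  ext i j
  rw [upperProd_eq_transpose, pascalBD_transpose, Matrix.mul_apply]
  simp only [Matrix.mul_diagonal, Matrix.transpose_apply, lowerProd_pascalBD]
  simp only [genPascal, Matrix.of_apply]
  rw [← sum_choose_mul_choose (Nat.lt_succ_iff.1 i.isLt) (j : ℕ), Finset.mul_sum]
  refine Finset.sum_congr rfl fun k _ => ?_
  by_cases hi : k ≤ i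
  · by_cases hj : k ≤ j
    · obtain ⟨a, ha⟩ := Nat.exists_eq_add_of_le (Fin.le_def.1 hi)
      obtain ⟨b, hb⟩ := Nat.exists_eq_add_of_le (Fin.le_def.1 hj)
      simp only [hi, hj, if_true, pascalBD, Matrix.of_apply, lt_self_iff_false, if_false]
      rw [ha, hb, Nat.add_sub_cancel_left, Nat.add_sub_cancel_left]
      ring
    · rw [Nat.choose_eq_zero_of_lt (Fin.lt_def.1 (not_le.1 hj))]
      simp [hj]
  · rw [Nat.choose_eq_zero_of_lt (Fin.lt_def.1 (not_le.1 hi))]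
    simp [hi]

/-! ### High relative accuracy -/

/-- Accumulation of relative errors in a rounded product. -/
theorem abs_rounded_mul_sub_le {a b v w δ u K L : ℝ} (hu : 0 ≤ u) (hu1 : u ≤ 1) (hK : 0 ≤ K)
    (hL : 0 ≤ L) (hv : |v - a| ≤ K * u * |a|) (hw : |w - b| ≤ L * u * |b|) (hδ : |δ| ≤ u) :
    |v * w * (1 + δ) - a * b| ≤ (2 * (K + L + K * L) + 1) * u * |a * b| := by
  have hvw : |v * w - a * b| ≤ (K + L + K * L) * u * |a * b| := by
    have e : v * w - a * b = (v - a) * b + a * (w - b) + (v - a) * (w - b) := by ring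
    -- The second-order error is absorbed into the linear one, keeping the constant independent of
    -- `u`.
    have huu : u * u ≤ u := by nlinarith
    calc |v * w - a * b|
        ≤ |v - a| * |b| + |a| * |w - b| + |v - a| * |w - b| := by
          rw [e, ← abs_mul, ← abs_mul, ← abs_mul]
          exact (abs_add_le _ _).trans (add_le_add_left (abs_add_le _ _) _)
      _ ≤ K * u * |a| * |b| + |a| * (L * u * |b|) + K * u * |a| * (L * u * |b|) := by gcongr
      _ = (K * u + L * u + K * L * (u * u)) * |a * b| := by rw [abs_mul]; ring
      _ ≤ (K * u + L * u + K * L * u) * |a * b| := by gcongr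
      _ = _ := by ring
  have e : v * w * (1 + δ) - a * b = (v * w - a * b) * (1 + δ) + a * b * δ := by ring
  have h1 : |1 + δ| ≤ 2 := by
    have := (abs_le.1 (hδ.trans hu1))
    rw [abs_le]; constructor <;> linarith
  calc |v * w * (1 + δ) - a * b|
      ≤ |v * w - a * b| * |1 + δ| + |a * b| * |δ| := by
        rw [e, ← abs_mul, ← abs_mul]; exact abs_add_le _ _
    _ ≤ (K + L + K * L) * u * |a * b| * 2 + |a * b| * u := by gcongr
    _ = _ := by ring

/-- An input operand: a datum, or the number `1`. -/
def inputOperand {p : ℕ} (N : ℕ) : Option (Fin p) → Operand p N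
  | some i => .data i
  | none => .one

/-- The value of an input operand. -/
def inputValue {p : ℕ} (d : Fin p → ℝ) : Option (Fin p) → ℝ
  | some i => d i
  | none => 1

theorem inputOperand_value {p N : ℕ} (d : Fin p → ℝ) (v : Fin N → ℝ) (a : Option (Fin p)) :
    (inputOperand N a).value d v = inputValue d a := by
  cases a <;> rfl

theorem inputOperand_before {p N : ℕ} (k : Fin N) (a : Option (Fin p)) :
    (inputOperand N a).Before k := by
  cases a <;> trivial

/-- The program which computes `α` and `β` by one operation each from the input, and then
the powers of `α * β` by repeated multiplication, and returns the bidiagonal decomposition of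
`R_n[α,β]`. -/
def pascalProgram (n : ℕ) {p : ℕ} (opα opβ : ArithOp) (lα rα lβ rβ : Option (Fin p)) :
    Program p (Fin (n + 1) × Fin (n + 1)) where
  -- Slots `0` and `1` hold `α` and `β`; slot `k + 2` holds `(α * β) ^ (k + 1)`. The last slot is
  -- never output when `n > 0` or `n = 0`, but it ensures that slot `2` always exists.
  size := n + 3
  op k := match (k : ℕ) with
    | 0 => opα
    | 1 => opβ
    | _ + 2 => .mul
  left k := match k with
    | ⟨0, _⟩ => inputOperand _ lα
    | ⟨1, _⟩ => inputOperand _ lβ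
    | ⟨2, _⟩ => .result ⟨0, by omega⟩
    | ⟨k + 3, h⟩ => .result ⟨k + 2, by omega⟩
  right k := match k with
    | ⟨0, _⟩ => inputOperand _ rα
    | ⟨1, _⟩ => inputOperand _ rβ
    | ⟨2, _⟩ => .result ⟨1, by omega⟩
    | ⟨_ + 3, _⟩ => .result ⟨2, by omega⟩
  left_before k := match k with
    | ⟨0, _⟩ => inputOperand_before _ _
    | ⟨1, _⟩ => inputOperand_before _ _
    | ⟨2, _⟩ => by simp [Operand.Before, Fin.lt_def]
    | ⟨k + 3, h⟩ => by simp [Operand.Before, Fin.lt_def]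
  right_before k := match k with
    | ⟨0, _⟩ => inputOperand_before _ _
    | ⟨1, _⟩ => inputOperand_before _ _
    | ⟨2, _⟩ => by simp [Operand.Before, Fin.lt_def]
    | ⟨k + 3, h⟩ => by simp [Operand.Before, Fin.lt_def]
  output q := if q.2 < q.1 then .result ⟨1, by omega⟩ else if q.1 < q.2 then .result ⟨0, by omega⟩ else
    if h : (q.1 : ℕ) = 0 then .one else .result ⟨(q.1 : ℕ) + 1, by omega⟩

/-- A bound for the relative error, in units of the round-off, of the computed power
`(α * β) ^ (k + 1)`. -/
def powErrorBound : ℕ → ℝ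
  -- `7 = 2 * (1 + 1 + 1 * 1) + 1` comes from `abs_rounded_mul_sub_le` with `K = L = 1`; each later
  -- power multiplies by slot `2`, so `L = 7`.
  | 0 => 7
  | k + 1 => 2 * (powErrorBound k + 7 + powErrorBound k * 7) + 1

theorem seven_le_powErrorBound (k : ℕ) : 7 ≤ powErrorBound k := by
  induction k with
  | zero => exact le_rfl
  | succ k ih => rw [powErrorBound]; linarith

theorem powErrorBound_mono : Monotone powErrorBound :=
  monotone_nat_of_le_succ fun k => by
    have := seven_le_powErrorBound k
    rw [powErrorBound]; linarith

theorem computableToHRA_pascalBD (n : ℕ) {p : ℕ} (S : Set (Fin p → ℝ)) (α β : (Fin p → ℝ) → ℝ)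
    (opα opβ : ArithOp) (lα rα lβ rβ : Option (Fin p))
    (hα : ∀ d ∈ S, opα.exact (inputValue d lα) (inputValue d rα) = α d)
    (hβ : ∀ d ∈ S, opβ.exact (inputValue d lβ) (inputValue d rβ) = β d)
    (hα0 : ∀ d ∈ S, opα = .div → inputValue d rα ≠ 0)
    (hβ0 : ∀ d ∈ S, opβ = .div → inputValue d rβ ≠ 0) :
    ComputableToHRA S fun d (q : Fin (n + 1) × Fin (n + 1)) =>
      pascalBD n (α d) (β d) q.1 q.2 := by
  refine ⟨pascalProgram n opα opβ lα rα lβ rβ, powErrorBound n,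
    by linarith [seven_le_powErrorBound n], fun d hd u hu hu2 v hrun => ⟨?_, ?_⟩⟩
  · rintro ⟨k, hk⟩ hdiv
    match k, hk, hdiv with
    | 0, _, hdiv => exact (inputOperand_value d v rα).trans_ne (hα0 d hd hdiv)
    | 1, _, hdiv => exact (inputOperand_value d v rβ).trans_ne (hβ0 d hd hdiv)
    | k + 2, _, hdiv => exact absurd hdiv (by simp [pascalProgram])
  · have hu1 : u ≤ 1 := by linarith
    have first : ∀ {a w δ : ℝ}, |δ| ≤ u → w = a * (1 + δ) → |w - a| ≤ 1 * u * |a| := by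
      intro a w δ hδ hw
      rw [hw, show a * (1 + δ) - a = δ * a by ring, abs_mul, one_mul]
      gcongr
    have h0 : |v (⟨0, by omega⟩ : Fin (n + 3)) - α d| ≤ 1 * u * |α d| := by
      obtain ⟨δ, hδ, h⟩ := hrun (⟨0, by omega⟩ : Fin (n + 3))
      refine first hδ (h.trans ?_)
      rw [← hα d hd, ← inputOperand_value d v lα, ← inputOperand_value d v rα]
      rfl
    have h1 : |v (⟨1, by omega⟩ : Fin (n + 3)) - β d| ≤ 1 * u * |β d| := by
      obtain ⟨δ, hδ, h⟩ := hrun (⟨1, by omega⟩ : Fin (n + 3))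
      refine first hδ (h.trans ?_)
      rw [← hβ d hd, ← inputOperand_value d v lβ, ← inputOperand_value d v rβ]
      rfl
    have h2 : |v (⟨2, by omega⟩ : Fin (n + 3)) - α d * β d| ≤ 7 * u * |α d * β d| := by
      obtain ⟨δ, hδ, h⟩ := hrun (⟨2, by omega⟩ : Fin (n + 3))
      have h' : v (⟨2, by omega⟩ : Fin (n + 3)) =
        v (⟨0, by omega⟩ : Fin (n + 3)) * v (⟨1, by omega⟩ : Fin (n + 3)) * (1 + δ) := h
      rw [h']
      convert abs_rounded_mul_sub_le hu.le hu1 zero_le_one zero_le_one h0 h1 hδ using 3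
      norm_num
    have hpow : ∀ (k : ℕ) (hk : k + 2 < n + 3), |v (⟨k + 2, hk⟩ : Fin (n + 3)) -
        (α d * β d) ^ (k + 1)| ≤ powErrorBound k * u * |(α d * β d) ^ (k + 1)| := by
      intro k
      induction k with
      | zero =>
        intro _
        have h2' := h2
        rw [← pow_one (α d * β d)] at h2'
        exact h2'
      | succ k ih =>
        intro hk
        obtain ⟨δ, hδ, h⟩ := hrun (⟨k + 3, hk⟩ : Fin (n + 3))
        have h' : v (⟨k + 3, hk⟩ : Fin (n + 3)) =
          v (⟨k + 2, by omega⟩ : Fin (n + 3)) * v (⟨2, by omega⟩ : Fin (n + 3)) * (1 + δ) := h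
        have := abs_rounded_mul_sub_le hu.le hu1 (by linarith [seven_le_powErrorBound k])
          (by norm_num) (ih (by omega)) h2 hδ
        rw [← h', ← pow_succ] at this
        exact this
    have weaken : ∀ {K w a : ℝ}, K ≤ powErrorBound n → |w - a| ≤ K * u * |a| →
        |w - a| ≤ powErrorBound n * u * |a| := fun hK h => h.trans (by gcongr)
    have hone : 1 ≤ powErrorBound n := by linarith [seven_le_powErrorBound n]
    rintro ⟨i, j⟩
    rcases lt_trichotomy i j with h | rfl | h
    · simp only [pascalProgram, pascalBD, Matrix.of_apply, h, h.not_gt, if_true, if_false]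
      exact weaken hone h0
    · by_cases hi : (i : ℕ) = 0
      · simp only [pascalProgram, pascalBD, Matrix.of_apply, lt_self_iff_false, if_false, hi,
          dif_pos, Operand.value, pow_zero, sub_self, abs_zero]
        positivity
      · obtain ⟨k, hk⟩ := Nat.exists_eq_succ_of_ne_zero hi
        simp only [pascalProgram, pascalBD, Matrix.of_apply, lt_self_iff_false, if_false, hi,
          dif_neg, not_false_eq_true, Operand.value]
        have hk2 : k + 2 < n + 3 := by omega
        have := weaken (powErrorBound_mono (by omega)) (hpow k hk2)
        simpa only [hk] using this
    · simp only [pascalProgram, pascalBD, Matrix.of_apply, h, if_true]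
      exact weaken hone h1

end PascalHRA

theorem mainTheorem5 (n : ℕ) :
    ((∀ x y : ℝ, 0 < x → 0 < y →
        PascalHRA.genPascal n x y = PascalHRA.latticePathMatrix n x y 0 ∧
        PascalHRA.IsSTP (PascalHRA.genPascal n x y)) ∧
      PascalHRA.BidiagonalDecompositionComputableToHRA {q : ℝ × ℝ | 0 < q.1 ∧ 0 < q.2}
        (PascalHRA.genPascal n)) ∧
    ((∀ x y : ℝ, 0 < x * y →
        PascalHRA.extPascal n x y = PascalHRA.latticePathMatrix n (y / x) (x * y) 0 ∧
        PascalHRA.IsSTP (PascalHRA.extPascal n x y)) ∧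
      PascalHRA.BidiagonalDecompositionComputableToHRA {q : ℝ × ℝ | 0 < q.1 * q.2}
        (PascalHRA.extPascal n)) := by
  have hne : ∀ {x y : ℝ}, 0 < x * y → x ≠ 0 := fun h => left_ne_zero_of_mul h.ne'
  have hdiv : ∀ {x y : ℝ}, 0 < x * y → 0 < y / x := fun {x y} h => by
    rw [div_pos_iff]
    rcases pos_and_pos_or_neg_and_neg_of_mul_pos h with h | h
    · exact Or.inl h.symm
    · exact Or.inr h.symm
  refine ⟨⟨fun x y hx hy => ⟨PascalHRA.genPascal_eq_latticePathMatrix n x y,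
      PascalHRA.isSTP_genPascal n hx hy⟩, PascalHRA.pascalBD n,
      fun x y h => PascalHRA.isBidiagonalDecomposition_genPascal n h.1 h.2, ?_⟩,
    ⟨fun x y h => ?_, fun x y => PascalHRA.pascalBD n (y / x) (x * y), fun x y h => ?_, ?_⟩⟩
  -- The data are passed to the common program through the operations `1 * x` and `1 * y`.
  · exact PascalHRA.computableToHRA_pascalBD n _ (fun d => d 0) (fun d => d 1) .mul .mul
      none (some 0) none (some 1) (fun d _ => one_mul _) (fun d _ => one_mul _)
      (fun _ _ h => by cases h) (fun _ _ h => by cases h)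
  · rw [PascalHRA.extPascal_eq_genPascal n (hne h)]
    exact ⟨PascalHRA.genPascal_eq_latticePathMatrix n _ _,
      PascalHRA.isSTP_genPascal n (hdiv h) h⟩
  · rw [PascalHRA.extPascal_eq_genPascal n (hne h)]
    exact PascalHRA.isBidiagonalDecomposition_genPascal n (hdiv h) h
  · exact PascalHRA.computableToHRA_pascalBD n _ (fun d => d 1 / d 0) (fun d => d 0 * d 1)
      .div .mul (some 1) (some 0) (some 0) (some 1) (fun d _ => rfl) (fun d _ => rfl)
      (fun d hd _ => hne hd) (fun _ _ h => by cases h)
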